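/- Let $A\in\mathbb C^{m\times m}$, $D\in\mathbb C^{n\times n}$, $B=L^BR^B$, $C=L^CR^C$ with $L^B\in\mathbb C^{m\times p}$, $R^B\in\mathbb C^{p\times n}$, $L^C\in\mathbb C^{n\times q}$, $R^C\in\mathbb C^{q\times m}$ (in particular, all of these may be real), and consider the nonsymmetric algebraic Riccati equation $$XCX-XD-AX+B=0,\qquad X\in\mathbb C^{m\times n}.\tag{1}$$ A solution $X$ is called stabilizing if all eigenvalues of $D-CX$ lie in the open left half-plane $\mathbb C_-$. Put $\mathcal H=\begin{bmatrix}D&-C\\B&-A\end{bmatrix}$, $A_\tau=\tau I+A$, $D_\tau=\tau I+D$, and $\mathcal C^{\alpha,\beta}(M)=(\alpha I+M)^{-1}(\beta I-M)$ for a matrix or a number $M$. Let $\alpha,\beta\in\mathbb C$ be such that (i) $D_\alpha$, $A_\beta$, $A_\beta-BD_\alpha^{-1}C$, $A_{-\alpha}-BD_\alpha^{-1}C$ and $D_{-\beta}-CA_\beta^{-1}B$ are nonsingular; (ii) $|\mathcal C^{\alpha,\beta}(\lambda_i)^{-1}|>|\mathcal C^{\alpha,\beta}(\lambda_j)^{-1}|$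 for all eigenvalues $\lambda_i\in\mathbb C_-$ and $\lambda_j\notin\mathbb C_-$ of $\mathcal H$; (iii) the fixed-point iteration $$X_0=0,\qquad X_{t+1}=H_0+F_0X_t(I-G_0X_t)^{-1}E_0$$ does not break down, i.e. $I-G_0X_t$ is nonsingular for all $t\ge 0$, where $$F_0=-(A_\beta-BD_\alpha^{-1}C)^{-1}(A_{-\alpha}-BD_\alpha^{-1}C),\quad E_0=-(D_\alpha-CA_\beta^{-1}B)^{-1}(D_{-\beta}-CA_\beta^{-1}B),$$ $$H_0=(\alpha+\beta)(A_\beta-BD_\alpha^{-1}C)^{-1}BD_\alpha^{-1},\quad G_0=(\alpha+\beta)(D_\alpha-CA_\beta^{-1}B)^{-1}CA_\beta^{-1}.$$ Let $\widetilde A=\mathcal C^{\beta,\alpha}(A)$, $\widetilde D=\mathcal C^{\alpha,\beta}(D)$, $L_B=A_\beta^{-1}L^B$, $R_C=(\alpha+\beta)R^CA_\beta^{-1}$, $Y^A=R^CA_\beta^{-1}L^B$, $L_C=D_\alpha^{-1}L^C$, $R_B=(\alpha+\beta)R^BD_\alpha^{-1}$, $Y^D=R^BD_\alpha^{-1}L^C$.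 For $t\ge1$ let $$U^A_t=\begin{bmatrix}L_B&\widetilde AL_B&\cdots&\widetilde A^{t-1}L_B\end{bmatrix},\qquad V^D_t=\begin{bmatrix}R_B\\R_B\widetilde D\\\vdots\\R_B\widetilde D^{t-1}\end{bmatrix},$$ let $T^A_t$ ($tq\times tp$) be the block upper triangular Toeplitz matrix with diagonal blocks $Y^A$ and $(i,j)$ block $R_C\widetilde A^{j-i-1}L_B$ for $i<j$, and let $T^D_t$ ($tp\times tq$) be the block lower triangular Toeplitz matrix with diagonal blocks $Y^D$ and $(i,j)$ block $R_B\widetilde D^{i-j-1}L_C$ for $i>j$. Let $\mathcal U^A,\mathcal V^D,\mathcal T^A,\mathcal T^D$ be the infinite block matrices given by the same formulas with block indices running over all positive integers. 1. For every $t\ge1$, the matrix $I-T^D_tT^A_t$ is nonsingular and $$X_t=U^A_t(I-T^D_tT^A_t)^{-1}V^D_t.$$ 2. Suppose that (1) has a stabilizing solution $X_\star$ and that the dual equation $YBY-YA-DY+C=0$ has a solution $Y_\star$ such that all eigenvalues of $A-BY_\star$ lie in the closed left half-plane (for instance, a stabilizing one). Then $X_\star$ is the only stabilizing solution of (1), $X_t\to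 X_\star$ as $t\to\infty$, and $$X_\star=\mathcal U^A(I-\mathcal T^D\mathcal T^A)^{-1}\mathcal V^D$$ in the following sense: $I-\mathcal T^D\mathcal T^A=\mathcal L\mathcal R$, where $\mathcal L$ is block lower triangular and $\mathcal R$ block upper triangular, each with a two-sided inverse of the same triangular shape, and the series over the blocks of $(\mathcal U^A\mathcal R^{-1})(\mathcal L^{-1}\mathcal V^D)$ converges absolutely to $X_\star$. -/

import Mathlib

open Matrix Filter Topology

/-- The coefficients of a nonsymmetric algebraic Riccati equation
`X C X - X D - A X + B = 0` with `B = LB * RB` and `C = LC * RC`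
(real coefficients are the special case of real entries). -/
structure NARE (m n p q : ℕ) where
  A : Matrix (Fin m) (Fin m) ℂ
  D : Matrix (Fin n) (Fin n) ℂ
  LB : Matrix (Fin m) (Fin p) ℂ
  RB : Matrix (Fin p) (Fin n) ℂ
  LC : Matrix (Fin n) (Fin q) ℂ
  RC : Matrix (Fin q) (Fin m) ℂ

/-- The generalized Cayley transformation `(α I + M)⁻¹ (β I - M)` of a matrix. -/
noncomputable def cayley {k : ℕ} (α β : ℂ) (M : Matrix (Fin k) (Fin k) ℂ) :
    Matrix (Fin k) (Fin k) ℂ :=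
  (α • (1 : Matrix (Fin k) (Fin k) ℂ) + M)⁻¹ * (β • (1 : Matrix (Fin k) (Fin k) ℂ) - M)

/-- The generalized Cayley transformation of a number. -/
noncomputable def cayleyNum (α β lam : ℂ) : ℂ := (α + lam)⁻¹ * (β - lam)

/-- The product of two possibly infinite matrices, entrywise by the usual sum. It is used only
where every one of these sums has finitely many nonzero terms: a row-finite left factor, a
column-finite right factor, in particular (lower triangular) times (anything), and
(anything) times (upper triangular). -/
noncomputable def infMul {I J K : Type*} (M : Matrix I K ℂ) (N : Matrix K J ℂ) : Matrix I J ℂ :=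
  Matrix.of fun i j => ∑ᶠ k, M i k * N k j

/-- Block lower triangular infinite matrices with `a × b` blocks. -/
def IsBlockLower {a b : ℕ} (M : Matrix (ℕ × Fin a) (ℕ × Fin b) ℂ) : Prop :=
  ∀ (i j : ℕ) (x : Fin a) (y : Fin b), i < j → M (i, x) (j, y) = 0

/-- Block upper triangular infinite matrices with `a × b` blocks. -/
def IsBlockUpper {a b : ℕ} (M : Matrix (ℕ × Fin a) (ℕ × Fin b) ℂ) : Prop :=
  ∀ (i j : ℕ) (x : Fin a) (y : Fin b), j < i → M (i, x) (j, y) = 0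

/-- `HasInfiniteForm U W V X` says `X = U W⁻¹ V` for an infinite block row `U`, an infinite block
matrix `W` and an infinite block column `V`, without any boundedness of these: `W` is the product
`L R` of an invertible block lower triangular matrix `L` and an invertible block upper triangular
matrix `R` (with inverses `L'`, `R'` of the same shape), so that `W⁻¹` is `R' L'`, and the series
over the blocks of `(U R') (L' V)` converges to `X`. The `t`-th partial sum of this series is the
same expression formed from the leading `t` blocks of `U`, `W` and `V`. -/
def HasInfiniteForm {m n p : ℕ} (U : Matrix (Fin m) (ℕ × Fin p) ℂ)
    (W : Matrix (ℕ × Fin p) (ℕ × Fin p) ℂ) (V : Matrix (ℕ × Fin p) (Fin n) ℂ)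
    (X : Matrix (Fin m) (Fin n) ℂ) : Prop :=
  ∃ L L' R R' : Matrix (ℕ × Fin p) (ℕ × Fin p) ℂ,
    IsBlockLower L ∧ IsBlockLower L' ∧ infMul L L' = 1 ∧ infMul L' L = 1 ∧
    IsBlockUpper R ∧ IsBlockUpper R' ∧ infMul R R' = 1 ∧ infMul R' R = 1 ∧
    infMul L R = W ∧
    HasSum (fun k : ℕ => (Matrix.of fun i j =>
      ∑ x : Fin p, infMul U R' i (k, x) * infMul L' V (k, x) j : Matrix (Fin m) (Fin n) ℂ)) X

namespace NARE

variable {m n p q : ℕ}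

def B (N : NARE m n p q) : Matrix (Fin m) (Fin n) ℂ := N.LB * N.RB

def C (N : NARE m n p q) : Matrix (Fin n) (Fin m) ℂ := N.LC * N.RC

/-- The linearizing (Hamiltonian-like) matrix. -/
def H (N : NARE m n p q) : Matrix (Fin n ⊕ Fin m) (Fin n ⊕ Fin m) ℂ :=
  Matrix.fromBlocks N.D (-N.C) N.B (-N.A)

/-- `X` is a stabilizing solution: it solves the equation, and all eigenvalues of `D - C X` lie in
the open left half plane. -/
def IsStabilizing (N : NARE m n p q) (X : Matrix (Fin m) (Fin n) ℂ) : Prop :=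
  X * N.C * X - X * N.D - N.A * X + N.B = 0 ∧
  ∀ μ ∈ spectrum ℂ (N.D - N.C * X), μ.re < 0

/-- `Y` is a (weakly) stabilizing solution of the dual equation `Y B Y - Y A - D Y + C = 0`: all
eigenvalues of `A - B Y` lie in the closed left half plane. -/
def IsWeaklyDualStabilizing (N : NARE m n p q) (Y : Matrix (Fin n) (Fin m) ℂ) : Prop :=
  Y * N.B * Y - Y * N.A - N.D * Y + N.C = 0 ∧
  ∀ μ ∈ spectrum ℂ (N.A - N.B * Y), μ.re ≤ 0

/-- `A_τ = τ I + A`. -/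
def As (N : NARE m n p q) (τ : ℂ) : Matrix (Fin m) (Fin m) ℂ :=
  τ • (1 : Matrix (Fin m) (Fin m) ℂ) + N.A

/-- `D_τ = τ I + D`. -/
def Ds (N : NARE m n p q) (τ : ℂ) : Matrix (Fin n) (Fin n) ℂ :=
  τ • (1 : Matrix (Fin n) (Fin n) ℂ) + N.D

/-- The invertibility assumption on the shifts. -/
def ShiftsInvertible (N : NARE m n p q) (α β : ℂ) : Prop :=
  IsUnit (N.Ds α) ∧ IsUnit (N.As β) ∧
  IsUnit (N.As β - N.B * (N.Ds α)⁻¹ * N.C) ∧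
  IsUnit (N.As (-α) - N.B * (N.Ds α)⁻¹ * N.C) ∧
  IsUnit (N.Ds (-β) - N.C * (N.As β)⁻¹ * N.B)

/-- The separation assumption on the eigenvalues of the linearizing matrix. -/
def Separated (N : NARE m n p q) (α β : ℂ) : Prop :=
  ∀ lamI ∈ spectrum ℂ N.H, lamI.re < 0 → ∀ lamJ ∈ spectrum ℂ N.H, 0 ≤ lamJ.re →
    ‖(cayleyNum α β lamJ)⁻¹‖ < ‖(cayleyNum α β lamI)⁻¹‖

noncomputable def F₀ (N : NARE m n p q) (α β : ℂ) : Matrix (Fin m) (Fin m) ℂ :=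
  -((N.As β - N.B * (N.Ds α)⁻¹ * N.C)⁻¹ * (N.As (-α) - N.B * (N.Ds α)⁻¹ * N.C))

noncomputable def E₀ (N : NARE m n p q) (α β : ℂ) : Matrix (Fin n) (Fin n) ℂ :=
  -((N.Ds α - N.C * (N.As β)⁻¹ * N.B)⁻¹ * (N.Ds (-β) - N.C * (N.As β)⁻¹ * N.B))

noncomputable def H₀ (N : NARE m n p q) (α β : ℂ) : Matrix (Fin m) (Fin n) ℂ :=
  (α + β) • ((N.As β - N.B * (N.Ds α)⁻¹ * N.C)⁻¹ * N.B * (N.Ds α)⁻¹)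

noncomputable def G₀ (N : NARE m n p q) (α β : ℂ) : Matrix (Fin n) (Fin m) ℂ :=
  (α + β) • ((N.Ds α - N.C * (N.As β)⁻¹ * N.B)⁻¹ * N.C * (N.As β)⁻¹)

/-- The fixed-point iteration `X₀ = 0`, `X_{t+1} = H₀ + F₀ X_t (I - G₀ X_t)⁻¹ E₀`
(so that `X₁ = H₀`). -/
noncomputable def iter (N : NARE m n p q) (α β : ℂ) : ℕ → Matrix (Fin m) (Fin n) ℂ
  | 0 => 0
  | t + 1 => N.H₀ α β + N.F₀ α β * N.iter α β t * (1 - N.G₀ α β * N.iter α β t)⁻¹ * N.E₀ α β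

/-- The iteration does not break down. -/
def NoBreakdown (N : NARE m n p q) (α β : ℂ) : Prop :=
  ∀ t : ℕ, IsUnit (1 - N.G₀ α β * N.iter α β t)

/-- `Ã = C^{β,α}(A)`. -/
noncomputable def At (N : NARE m n p q) (α β : ℂ) : Matrix (Fin m) (Fin m) ℂ := cayley β α N.A

/-- `D̃ = C^{α,β}(D)`. -/
noncomputable def Dt (N : NARE m n p q) (α β : ℂ) : Matrix (Fin n) (Fin n) ℂ := cayley α β N.D

/-- `L_B = A_β⁻¹ L^B`. -/
noncomputable def LBs (N : NARE m n p q) (β : ℂ) : Matrix (Fin m) (Fin p) ℂ :=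
  (N.As β)⁻¹ * N.LB

/-- `R_C = (α + β) R^C A_β⁻¹`. -/
noncomputable def RCs (N : NARE m n p q) (α β : ℂ) : Matrix (Fin q) (Fin m) ℂ :=
  (α + β) • (N.RC * (N.As β)⁻¹)

/-- `Y^A = R^C A_β⁻¹ L^B`. -/
noncomputable def YA (N : NARE m n p q) (β : ℂ) : Matrix (Fin q) (Fin p) ℂ :=
  N.RC * (N.As β)⁻¹ * N.LB

/-- `L_C = D_α⁻¹ L^C`. -/
noncomputable def LCs (N : NARE m n p q) (α : ℂ) : Matrix (Fin n) (Fin q) ℂ :=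
  (N.Ds α)⁻¹ * N.LC

/-- `R_B = (α + β) R^B D_α⁻¹`. -/
noncomputable def RBs (N : NARE m n p q) (α β : ℂ) : Matrix (Fin p) (Fin n) ℂ :=
  (α + β) • (N.RB * (N.Ds α)⁻¹)

/-- `Y^D = R^B D_α⁻¹ L^C`. -/
noncomputable def YD (N : NARE m n p q) (α : ℂ) : Matrix (Fin p) (Fin q) ℂ :=
  N.RB * (N.Ds α)⁻¹ * N.LC

/-- Block `(i, j)`, counted from `0`, of the upper triangular block Toeplitz matrices. -/
noncomputable def blockTA (N : NARE m n p q) (α β : ℂ) (i j : ℕ) : Matrix (Fin q) (Fin p) ℂ :=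
  if i = j then N.YA β
  else if i < j then N.RCs α β * N.At α β ^ (j - i - 1) * N.LBs β
  else 0

/-- Block `(i, j)`, counted from `0`, of the lower triangular block Toeplitz matrices. -/
noncomputable def blockTD (N : NARE m n p q) (α β : ℂ) (i j : ℕ) : Matrix (Fin p) (Fin q) ℂ :=
  if i = j then N.YD α
  else if j < i then N.RBs α β * N.Dt α β ^ (i - j - 1) * N.LCs α
  else 0

/-- `U^A_t = [L_B, Ã L_B, …, Ã^{t-1} L_B]`. -/
noncomputable def UA (N : NARE m n p q) (α β : ℂ) (t : ℕ) : Matrix (Fin m) (Fin t × Fin p) ℂ :=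
  Matrix.of fun i k => (N.At α β ^ (k.1 : ℕ) * N.LBs β) i k.2

/-- `V^D_t`, with the block rows `R_B, R_B D̃, …, R_B D̃^{t-1}`. -/
noncomputable def VD (N : NARE m n p q) (α β : ℂ) (t : ℕ) : Matrix (Fin t × Fin p) (Fin n) ℂ :=
  Matrix.of fun k j => (N.RBs α β * N.Dt α β ^ (k.1 : ℕ)) k.2 j

/-- `T^A_t`, of size `tq × tp`. -/
noncomputable def TA (N : NARE m n p q) (α β : ℂ) (t : ℕ) :
    Matrix (Fin t × Fin q) (Fin t × Fin p) ℂ :=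
  Matrix.of fun k l => N.blockTA α β k.1 l.1 k.2 l.2

/-- `T^D_t`, of size `tp × tq`. -/
noncomputable def TD (N : NARE m n p q) (α β : ℂ) (t : ℕ) :
    Matrix (Fin t × Fin p) (Fin t × Fin q) ℂ :=
  Matrix.of fun k l => N.blockTD α β k.1 l.1 k.2 l.2

/-- The infinite block row `[L_B, Ã L_B, Ã² L_B, …]`. -/
noncomputable def UAInf (N : NARE m n p q) (α β : ℂ) : Matrix (Fin m) (ℕ × Fin p) ℂ :=
  Matrix.of fun i k => (N.At α β ^ k.1 * N.LBs β) i k.2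

/-- The infinite block column with the block rows `R_B, R_B D̃, R_B D̃², …`. -/
noncomputable def VDInf (N : NARE m n p q) (α β : ℂ) : Matrix (ℕ × Fin p) (Fin n) ℂ :=
  Matrix.of fun k j => (N.RBs α β * N.Dt α β ^ k.1) k.2 j

/-- The infinite upper triangular block Toeplitz matrix. -/
noncomputable def TAInf (N : NARE m n p q) (α β : ℂ) :
    Matrix (ℕ × Fin q) (ℕ × Fin p) ℂ :=
  Matrix.of fun k l => N.blockTA α β k.1 l.1 k.2 l.2

/-- The infinite lower triangular block Toeplitz matrix. -/
noncomputable def TDInf (N : NARE m n p q) (α β : ℂ) :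
    Matrix (ℕ × Fin p) (ℕ × Fin q) ℂ :=
  Matrix.of fun k l => N.blockTD α β k.1 l.1 k.2 l.2

end NARE

/-!
Let `H = [[D, -C], [B, -A]]` be the linearizing matrix. Everything rests on the linear recurrence
`(α I + H) [u_k; v_k] = (β I - H) [u_{k+1}; v_{k+1}]` (`NARE.Step`). Premultiplied by a suitable
nonsingular matrix it reads `u_k = E₀ u_{k+1} + G₀ v_k`, `v_{k+1} = H₀ u_{k+1} + F₀ v_k`, so it
maps the graph of the iterate `X_k` to the graph of `X_{k+1}`: a trajectory with `v_0 = 0`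
satisfies `v_t = X_t u_t`, and it vanishes if `u_t = 0` (`NARE.eq_iter_mul_of_steps`).

*Finite form.* Multiplied instead by the inverses of `D_α` and `A_β`, the recurrence becomes a
recursion for `u` with matrix `D̃` running backwards, driven by `x = R^C (v_k + v_{k+1})`, and one
for `v` with matrix `Ã` running forwards, driven by `y = R^B (u_k + u_{k+1})`. Summed up with
`v_0 = 0` and `u_t = z`, they say `x = T^A_t y`, `y = V^D_t z + T^D_t x` and `v_t = U^A_t y`. For
`z = 0` this forces `y = 0`, so `I - T^D_t T^A_t` is nonsingular, and for general `z` it is the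
formula for `X_t` (`NARE.UA_mul_eq_iter_mul`).

*Convergence.* The graphs `[I; X]` of a solution and `[Y; I]` of a dual solution are invariant under
`H`. Combining a trajectory on each of them yields `X_t (I - Y Q_t) = X - Q_t` with
`Q_t = Γ^t X Λ^t`, where `Λ` and `Γ` are the Cayley transforms of `D - C X` and `A - B Y`
(`NARE.iter_mul_one_sub`). The separation hypothesis says that the product of the spectral radii of
`Γ` and `Λ` is less than one, so `‖Q_t‖`, and with it `‖X_t - X‖`, decays geometrically. Since this
holds for every stabilizing `X`, uniqueness is uniqueness of limits.

*Infinite form.* The leading truncations of `I - 𝒯^D 𝒯^A` are the matrices `I - T^D_t T^A_t`. As they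
are all nonsingular, block Gauss elimination gives the triangular factors
(`exists_isBlockLower_infMul_isBlockUpper`), and the partial sums of the series are the `X_t`
(`hasInfiniteForm_of_hasSum`).
-/

/-! ### Step relations and the iteration -/

/-- The two Schur complements of `[[P, C], [B, Q]]` are nonsingular together, when `P` and `Q`
are. -/
theorem Matrix.isUnit_schur_swap {k l : ℕ} {P : Matrix (Fin l) (Fin l) ℂ}
    {Q : Matrix (Fin k) (Fin k) ℂ} {B : Matrix (Fin k) (Fin l) ℂ} {C : Matrix (Fin l) (Fin k) ℂ}
    (hP : IsUnit P) (hQ : IsUnit Q) (h : IsUnit (Q - B * P⁻¹ * C)) :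
    IsUnit (P - C * Q⁻¹ * B) := by
  let _ := hP.invertible
  let _ := hQ.invertible
  rw [← Matrix.invOf_eq_nonsing_inv, ← isUnit_fromBlocks_iff_of_invertible₂₂]
  rwa [← Matrix.invOf_eq_nonsing_inv, ← isUnit_fromBlocks_iff_of_invertible₁₁] at h

/-- Elimination of `v'` from the coupled relations. The statement is symmetric under exchanging
`(P, C, u, u')` with `(Q, B, v', v)`, so it also eliminates `u`. -/
theorem Matrix.eq_of_coupled_step {k l r : ℕ} {P P' : Matrix (Fin l) (Fin l) ℂ}
    {Q Q' : Matrix (Fin k) (Fin k) ℂ} {B : Matrix (Fin k) (Fin l) ℂ}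
    {C : Matrix (Fin l) (Fin k) ℂ} {γ : ℂ} {u u' : Matrix (Fin l) (Fin r) ℂ}
    {v v' : Matrix (Fin k) (Fin r) ℂ} (hQ : IsUnit Q) (hPQ : IsUnit (P - C * Q⁻¹ * B))
    (hγ : Q = Q' + γ • (1 : Matrix (Fin k) (Fin k) ℂ))
    (h₁ : P * u = -(P' * u') + C * (v + v')) (h₂ : Q * v' = -(Q' * v) + B * (u + u')) :
    u = -((P - C * Q⁻¹ * B)⁻¹ * (P' - C * Q⁻¹ * B)) * u' +
      (γ • ((P - C * Q⁻¹ * B)⁻¹ * C * Q⁻¹)) * v := by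
  have hQ' := (Matrix.isUnit_iff_isUnit_det Q).mp hQ
  have hS := (Matrix.isUnit_iff_isUnit_det _).mp hPQ
  have hv' : v' = Q⁻¹ * (-(Q' * v) + B * (u + u')) := by
    rw [← h₂, Matrix.nonsing_inv_mul_cancel_left _ _ hQ']
  have hQQ : Q⁻¹ * (Q' * v) = v - γ • (Q⁻¹ * v) := by
    have : Q' = Q - γ • (1 : Matrix (Fin k) (Fin k) ℂ) := by rw [hγ]; simp
    rw [this, Matrix.sub_mul, Matrix.mul_sub, Matrix.nonsing_inv_mul_cancel_left _ _ hQ']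
    simp
  have key : (P - C * Q⁻¹ * B) * u =
      -((P' - C * Q⁻¹ * B) * u') + γ • (C * (Q⁻¹ * v)) := by
    rw [Matrix.sub_mul, h₁]
    nth_rewrite 1 [hv']
    simp only [Matrix.mul_add, Matrix.mul_neg, hQQ, Matrix.mul_sub, Matrix.mul_smul,
      Matrix.sub_mul, Matrix.mul_assoc]
    abel
  rw [← Matrix.nonsing_inv_mul_cancel_left _ u hS, key]
  simp [Matrix.mul_add, Matrix.mul_assoc]

theorem cayley_mul {k r : ℕ} {α β : ℂ} {M : Matrix (Fin k) (Fin k) ℂ}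
    (h : IsUnit (α • (1 : Matrix (Fin k) (Fin k) ℂ) + M)) (u : Matrix (Fin k) (Fin r) ℂ) :
    (α • (1 : Matrix (Fin k) (Fin k) ℂ) + M) * (cayley α β M * u) =
      (β • (1 : Matrix (Fin k) (Fin k) ℂ) - M) * u := by
  rw [cayley, Matrix.mul_assoc,
    Matrix.mul_nonsing_inv_cancel_left _ _ ((Matrix.isUnit_iff_isUnit_det _).mp h)]

theorem add_cayley_mul {k r : ℕ} {α β : ℂ} {M : Matrix (Fin k) (Fin k) ℂ}
    (h : IsUnit (α • (1 : Matrix (Fin k) (Fin k) ℂ) + M)) (u : Matrix (Fin k) (Fin r) ℂ) :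
    u + cayley α β M * u = (α + β) • ((α • (1 : Matrix (Fin k) (Fin k) ℂ) + M)⁻¹ * u) := by
  have hd := (Matrix.isUnit_iff_isUnit_det _).mp h
  nth_rewrite 1 [← Matrix.nonsing_inv_mul_cancel_left _ u hd]
  rw [cayley, Matrix.mul_assoc, ← Matrix.mul_add, ← Matrix.add_mul, ← Matrix.mul_smul]
  congr 1
  have : α • (1 : Matrix (Fin k) (Fin k) ℂ) + M + (β • (1 : Matrix (Fin k) (Fin k) ℂ) - M) =
      (α + β) • 1 := by rw [add_smul]; abel
  rw [this]; simp

namespace NARE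

variable {m n p q : ℕ}

/-- Two consecutive states `(u, v)`, `(u', v')` of the linear recurrence
`(α I + H) [u; v] = (β I - H) [u'; v']` attached to the linearizing matrix `H`, each state being a
block of `r` columns. -/
def Step (N : NARE m n p q) (α β : ℂ) {r : ℕ} (u u' : Matrix (Fin n) (Fin r) ℂ)
    (v v' : Matrix (Fin m) (Fin r) ℂ) : Prop :=
  N.Ds α * u = -(N.Ds (-β) * u') + N.C * (v + v') ∧
  N.As β * v' = -(N.As (-α) * v) + N.B * (u + u')

/-- The recurrence in standard form: multiplying `β I - H` and `α I + H` by a common nonsingular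
matrix turns them into `[[E₀, 0], [-H₀, I]]` and `[[I, -G₀], [0, F₀]]`. -/
theorem Step.eq_standard_form {N : NARE m n p q} {α β : ℂ} {r : ℕ} {u u' : Matrix (Fin n) (Fin r) ℂ}
    {v v' : Matrix (Fin m) (Fin r) ℂ} (hinv : N.ShiftsInvertible α β) (h : N.Step α β u u' v v') :
    u = N.E₀ α β * u' + N.G₀ α β * v ∧ v' = N.H₀ α β * u' + N.F₀ α β * v := by
  obtain ⟨hD, hA, hS, -, -⟩ := hinv
  have hγA : N.As β = N.As (-α) + (α + β) • 1 := by simp only [As, neg_smul, add_smul]; abel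
  have hγD : N.Ds α = N.Ds (-β) + (α + β) • 1 := by simp only [Ds, neg_smul, add_smul]; abel
  constructor
  · exact eq_of_coupled_step hA (isUnit_schur_swap hD hA hS) hγA h.1 h.2
  · rw [add_comm (N.H₀ α β * u')]
    exact eq_of_coupled_step hD hS hγD (by rw [h.2, add_comm u]) (by rw [h.1, add_comm v])

/-- A step carries the graph of `X_s` to the graph of `X_{s+1}`. -/
theorem Step.iter_mul {N : NARE m n p q} {α β : ℂ} {r : ℕ} {u u' : Matrix (Fin n) (Fin r) ℂ}
    {v v' : Matrix (Fin m) (Fin r) ℂ} (hinv : N.ShiftsInvertible α β) (hnb : N.NoBreakdown α β)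
    (h : N.Step α β u u' v v') {s : ℕ} (hv : v = N.iter α β s * u) :
    u = (1 - N.G₀ α β * N.iter α β s)⁻¹ * (N.E₀ α β * u') ∧ v' = N.iter α β (s + 1) * u' := by
  obtain ⟨h₁, h₂⟩ := h.eq_standard_form hinv
  have hu : u = (1 - N.G₀ α β * N.iter α β s)⁻¹ * (N.E₀ α β * u') := by
    have : (1 - N.G₀ α β * N.iter α β s) * u = N.E₀ α β * u' := by
      rw [Matrix.sub_mul, Matrix.one_mul, Matrix.mul_assoc, ← hv, sub_eq_iff_eq_add]
      exact h₁
    rw [← this, Matrix.nonsing_inv_mul_cancel_left _ _ ((Matrix.isUnit_iff_isUnit_det _).mp (hnb s))]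
  refine ⟨hu, ?_⟩
  rw [h₂, hv, iter, Matrix.add_mul]
  nth_rewrite 1 [hu]
  simp only [Matrix.mul_assoc]

/-- A trajectory, indexed backwards in time, that starts at time `t` with vanishing second
component lies on the graph of `X_{t-j}` at index `j`; it vanishes as soon as the first component
of its final state does. -/
theorem eq_iter_mul_of_steps {N : NARE m n p q} {α β : ℂ} {r t : ℕ}
    {U : ℕ → Matrix (Fin n) (Fin r) ℂ}
    {V : ℕ → Matrix (Fin m) (Fin r) ℂ} (hinv : N.ShiftsInvertible α β) (hnb : N.NoBreakdown α β)
    (hV : V t = 0) (h : ∀ j < t, N.Step α β (U (j + 1)) (U j) (V (j + 1)) (V j)) :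
    V 0 = N.iter α β t * U 0 ∧ (U 0 = 0 → ∀ j ≤ t, U j = 0 ∧ V j = 0) := by
  have hall : ∀ s j, j + s = t → V j = N.iter α β s * U j := by
    intro s
    induction s with
    | zero => rintro j rfl; simpa [iter] using hV
    | succ s ih => exact fun j hj => ((h j (by omega)).iter_mul hinv hnb (ih (j + 1) (by omega))).2
  refine ⟨hall t 0 (by omega), fun h0 => ?_⟩
  have hU : ∀ j ≤ t, U j = 0 := by
    intro j
    induction j with
    | zero => exact fun _ => h0
    | succ j ih =>
      intro hj
      rw [((h j (by omega)).iter_mul hinv hnb (hall (t - (j + 1)) (j + 1) (by omega))).1,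
        ih (by omega)]
      simp
  exact fun j hj => ⟨hU j hj, by rw [hall (t - j) j (by omega), hU j hj, Matrix.mul_zero]⟩

end NARE

/-! ### Finite block Toeplitz systems -/

/-- The `j`-th block row of a matrix with `t` block rows of height `a`, continued by zero to all
`j ≥ t`. -/
def Matrix.rowBlock {K : Type*} {t a : ℕ} (M : Matrix (Fin t × Fin a) K ℂ) (j : ℕ) :
    Matrix (Fin a) K ℂ :=
  Matrix.of fun x c => if h : j < t then M (⟨j, h⟩, x) c else 0

theorem Matrix.rowBlock_of_mul {K : Type*} {t a b : ℕ} (f : ℕ → ℕ → Matrix (Fin a) (Fin b) ℂ)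
    (y : Matrix (Fin t × Fin b) K ℂ) {j : ℕ} (hj : j < t) :
    ((Matrix.of fun k l => f k.1 l.1 k.2 l.2 : Matrix (Fin t × Fin a) (Fin t × Fin b) ℂ) *
      y).rowBlock j = ∑ l ∈ Finset.range t, f j l * y.rowBlock l := by
  ext x c
  simp [rowBlock, hj, Matrix.mul_apply, Fintype.sum_prod_type, Finset.sum_range, Matrix.sum_apply]

namespace NARE

variable {m n p q : ℕ}

theorem sum_blockTA_mul (N : NARE m n p q) (α β : ℂ) {r t j : ℕ} (hj : j < t)
    (y : ℕ → Matrix (Fin p) (Fin r) ℂ) :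
    ∑ l ∈ Finset.range t, N.blockTA α β j l * y l = N.YA β * y j +
      N.RCs α β * ∑ i ∈ Finset.Ico (j + 1) t, N.At α β ^ (i - (j + 1)) * (N.LBs β * y i) := by
  rw [Finset.range_eq_Ico, ← Finset.sum_Ico_consecutive _ (Nat.zero_le j) hj.le,
    Finset.sum_eq_zero, zero_add, Finset.sum_eq_sum_Ico_succ_bot hj, Matrix.mul_sum]
  · congr 1
    · simp [blockTA]
    · refine Finset.sum_congr rfl fun i hi => ?_
      have := (Finset.mem_Ico.mp hi).1
      rw [blockTA, if_neg (by omega), if_pos (by omega), Nat.sub_sub]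
      simp only [Matrix.mul_assoc]
  · intro i hi
    have := (Finset.mem_Ico.mp hi).2
    rw [blockTA, if_neg (by omega), if_neg (by omega), Matrix.zero_mul]

theorem sum_blockTD_mul (N : NARE m n p q) (α β : ℂ) {r t j : ℕ} (hj : j < t)
    (x : ℕ → Matrix (Fin q) (Fin r) ℂ) :
    ∑ i ∈ Finset.range t, N.blockTD α β j i * x i = N.YD α * x j +
      N.RBs α β * ∑ i ∈ Finset.range j, N.Dt α β ^ (j - 1 - i) * (N.LCs α * x i) := by
  rw [Finset.range_eq_Ico, ← Finset.sum_Ico_consecutive _ (Nat.zero_le (j + 1)) hj,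
    ← Finset.range_eq_Ico, Finset.sum_range_succ, Matrix.mul_sum, add_comm (N.YD α * x j)]
  rw [Finset.sum_eq_zero (s := Finset.Ico (j + 1) t), add_zero]
  · congr 1
    · refine Finset.sum_congr rfl fun i hi => ?_
      have := Finset.mem_range.mp hi
      rw [blockTD, if_neg (by omega), if_pos (by omega), Nat.sub_right_comm]
      simp only [Matrix.mul_assoc]
    · simp [blockTD]
  · intro i hi
    have := (Finset.mem_Ico.mp hi).1
    rw [blockTD, if_neg (by omega), if_neg (by omega), Matrix.zero_mul]

/-- The Toeplitz relations are the recurrence in disguise: with `x = R^C (v + v')` and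
`y = R^B (u + u')` as the coupling variables, a step splits into a recursion for `v` driven by
`y` and a recursion for `u` driven by `x`. -/
theorem step_of_recursion {N : NARE m n p q} {α β : ℂ} (hinv : N.ShiftsInvertible α β) {r : ℕ}
    {u u' : Matrix (Fin n) (Fin r) ℂ} {v v' : Matrix (Fin m) (Fin r) ℂ}
    {x : Matrix (Fin q) (Fin r) ℂ} {y : Matrix (Fin p) (Fin r) ℂ}
    (hv : v' = N.LBs β * y + N.At α β * v) (hu : u = N.Dt α β * u' + N.LCs α * x)
    (hx : x = N.YA β * y + N.RCs α β * v) (hy : y = N.RBs α β * u' + N.YD α * x) :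
    x = N.RC * (v + v') ∧ y = N.RB * (u + u') ∧ N.Step α β u u' v v' := by
  have hDu : IsUnit (α • (1 : Matrix (Fin n) (Fin n) ℂ) + N.D) := hinv.1
  have hAu : IsUnit (β • (1 : Matrix (Fin m) (Fin m) ℂ) + N.A) := hinv.2.1
  have hD' := (Matrix.isUnit_iff_isUnit_det _).mp hinv.1
  have hA' := (Matrix.isUnit_iff_isUnit_det _).mp hinv.2.1
  have hvs : v + v' = N.LBs β * y + (α + β) • ((N.As β)⁻¹ * v) := by
    rw [hv, add_left_comm, add_comm α, As, ← add_cayley_mul hAu]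
    rfl
  have hus : u + u' = (α + β) • ((N.Ds α)⁻¹ * u') + N.LCs α * x := by
    rw [hu, add_right_comm, add_comm (_ * u'), Ds, ← add_cayley_mul hDu]
    rfl
  have hxv : x = N.RC * (v + v') := by
    rw [hvs, Matrix.mul_add, hx, YA, LBs, RCs]
    simp only [Matrix.mul_smul, Matrix.smul_mul, Matrix.mul_assoc]
  have hyu : y = N.RB * (u + u') := by
    rw [hus, Matrix.mul_add, hy, YD, LCs, RBs]
    simp only [Matrix.mul_smul, Matrix.smul_mul, Matrix.mul_assoc]
  refine ⟨hxv, hyu, ?_, ?_⟩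
  · have h : N.Ds α * (N.Dt α β * u') = -(N.Ds (-β) * u') := by
      rw [Ds, Dt, cayley_mul hDu, ← Matrix.neg_mul]
      congr 1
      simp only [Ds, neg_smul]
      abel
    rw [C, Matrix.mul_assoc, ← hxv, hu, Matrix.mul_add, h, LCs, Matrix.mul_assoc,
      Matrix.mul_nonsing_inv_cancel_left _ _ hD']
  · have h : N.As β * (N.At α β * v) = -(N.As (-α) * v) := by
      rw [As, At, cayley_mul hAu, ← Matrix.neg_mul]
      congr 1
      simp only [As, neg_smul]
      abel
    rw [B, Matrix.mul_assoc, ← hyu, hv, Matrix.mul_add, h, LBs, Matrix.mul_assoc,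
      Matrix.mul_nonsing_inv_cancel_left _ _ hA', add_comm]

/-- A solution `y` of `y = V^D_t z + T^D_t T^A_t y`, written block by block, generates a trajectory
of the recurrence that ends in first component `z` and second component `U^A_t y`. -/
theorem sum_eq_iter_mul {N : NARE m n p q} {α β : ℂ} (hinv : N.ShiftsInvertible α β)
    (hnb : N.NoBreakdown α β) {r t : ℕ} (z : Matrix (Fin n) (Fin r) ℂ)
    (y : ℕ → Matrix (Fin p) (Fin r) ℂ)
    (hy : ∀ j < t, y j = N.RBs α β * N.Dt α β ^ j * z + ∑ i ∈ Finset.range t,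
      N.blockTD α β j i * ∑ l ∈ Finset.range t, N.blockTA α β i l * y l) :
    ∑ j ∈ Finset.range t, N.At α β ^ j * (N.LBs β * y j) = N.iter α β t * z ∧
      (z = 0 → ∀ j < t, y j = 0) := by
  -- `x = T^A_t y` and the states `U`, `V` are the sums of variation of constants, where index `j`
  -- stands for time `t - j`.
  set x : ℕ → Matrix (Fin q) (Fin r) ℂ :=
    fun i => ∑ l ∈ Finset.range t, N.blockTA α β i l * y l with hx
  set V : ℕ → Matrix (Fin m) (Fin r) ℂ :=
    fun j => ∑ i ∈ Finset.Ico j t, N.At α β ^ (i - j) * (N.LBs β * y i) with hV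
  set U : ℕ → Matrix (Fin n) (Fin r) ℂ :=
    fun j => N.Dt α β ^ j * z +
      ∑ i ∈ Finset.range j, N.Dt α β ^ (j - 1 - i) * (N.LCs α * x i) with hU
  have hVs : ∀ j < t, V j = N.LBs β * y j + N.At α β * V (j + 1) := by
    intro j hj
    simp only [hV]
    rw [Finset.sum_eq_sum_Ico_succ_bot hj, Matrix.mul_sum]
    congr 1
    · simp
    · refine Finset.sum_congr rfl fun i hi => ?_
      have := (Finset.mem_Ico.mp hi).1
      rw [show i - j = (i - (j + 1)) + 1 by omega, pow_succ', Matrix.mul_assoc]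
  have hUs : ∀ j, U (j + 1) = N.Dt α β * U j + N.LCs α * x j := by
    intro j
    simp only [hU]
    rw [Finset.sum_range_succ, Matrix.mul_add, Matrix.mul_sum (M := N.Dt α β), pow_succ', Matrix.mul_assoc,
      ← add_assoc]
    congr 1
    · congr 1
      refine Finset.sum_congr rfl fun i hi => ?_
      have := Finset.mem_range.mp hi
      rw [← Matrix.mul_assoc (N.Dt α β), ← pow_succ']
      congr 2
      omega
    · simp
  have hxy : ∀ j < t, x j = N.YA β * y j + N.RCs α β * V (j + 1) ∧
      y j = N.RBs α β * U j + N.YD α * x j := by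
    intro j hj
    refine ⟨N.sum_blockTA_mul α β hj y, ?_⟩
    rw [hy j hj, N.sum_blockTD_mul α β hj x, add_left_comm, Matrix.mul_assoc _ _ z,
      ← Matrix.mul_add, add_comm]
  have hst := fun j (hj : j < t) =>
    step_of_recursion hinv (hVs j hj) (hUs j) (hxy j hj).1 (hxy j hj).2
  obtain ⟨h₁, h₂⟩ := eq_iter_mul_of_steps (t := t) hinv hnb (by simp [hV]) fun j hj => (hst j hj).2.2
  have hU0 : U 0 = z := by simp [hU]
  refine ⟨?_, fun hz j hj => ?_⟩
  · rw [← hU0, ← h₁]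
    simp [hV]
  · have h := h₂ (hU0.trans hz)
    rw [(hst j hj).2.1, (h _ hj).1, (h j hj.le).1]
    simp

theorem UA_mul_eq_iter_mul {N : NARE m n p q} {α β : ℂ} (hinv : N.ShiftsInvertible α β)
    (hnb : N.NoBreakdown α β) {r t : ℕ} {z : Matrix (Fin n) (Fin r) ℂ}
    {y : Matrix (Fin t × Fin p) (Fin r) ℂ}
    (hy : (1 - N.TD α β t * N.TA α β t) * y = N.VD α β t * z) :
    N.UA α β t * y = N.iter α β t * z ∧ (z = 0 → y = 0) := by
  have hy' : y = N.VD α β t * z + N.TD α β t * (N.TA α β t * y) := by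
    rw [← hy, Matrix.sub_mul, Matrix.one_mul, Matrix.mul_assoc, sub_add_cancel]
  have hrow : ∀ j < t, y.rowBlock j = N.RBs α β * N.Dt α β ^ j * z + ∑ i ∈ Finset.range t,
      N.blockTD α β j i * ∑ l ∈ Finset.range t, N.blockTA α β i l * y.rowBlock l := by
    intro j hj
    have h₁ : y.rowBlock j = (N.VD α β t * z).rowBlock j +
        (N.TD α β t * (N.TA α β t * y)).rowBlock j := by
      nth_rewrite 1 [hy']
      ext x c
      simp [rowBlock, hj]
    rw [h₁, TD, rowBlock_of_mul _ _ hj]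
    congr 1
    · ext x c
      simp [rowBlock, hj, VD, Matrix.mul_apply]
    · refine Finset.sum_congr rfl fun i hi => ?_
      rw [TA, rowBlock_of_mul _ _ (Finset.mem_range.mp hi)]
  obtain ⟨h₁, h₂⟩ := sum_eq_iter_mul hinv hnb z _ hrow
  constructor
  · rw [← h₁]
    ext a c
    simp only [← Matrix.mul_assoc]
    simp [Matrix.mul_apply, Matrix.sum_apply, rowBlock, UA, Fintype.sum_prod_type,
      Finset.sum_range]
  · intro hz
    ext ⟨j, x⟩ c
    simpa [rowBlock] using congrFun (congrFun (h₂ hz j j.2) x) c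

theorem isUnit_one_sub_TD_mul_TA {N : NARE m n p q} {α β : ℂ} (hinv : N.ShiftsInvertible α β)
    (hnb : N.NoBreakdown α β) (t : ℕ) : IsUnit (1 - N.TD α β t * N.TA α β t) := by
  rw [← Matrix.mulVec_injective_iff_isUnit]
  refine (injective_iff_map_eq_zero (Matrix.mulVecLin (1 - N.TD α β t * N.TA α β t))).mpr
    fun v hv => ?_
  have h := (UA_mul_eq_iter_mul hinv hnb (z := (0 : Matrix (Fin n) (Fin 1) ℂ))
    (y := Matrix.replicateCol (Fin 1) v) (by
      rw [← Matrix.replicateCol_mulVec, Matrix.mul_zero]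
      rw [Matrix.mulVecLin_apply] at hv
      rw [hv]; rfl)).2 rfl
  exact funext fun k => congrFun (congrFun h k) 0

theorem iter_eq_UA_mul {N : NARE m n p q} {α β : ℂ} (hinv : N.ShiftsInvertible α β)
    (hnb : N.NoBreakdown α β) (t : ℕ) :
    N.iter α β t = N.UA α β t * (1 - N.TD α β t * N.TA α β t)⁻¹ * N.VD α β t := by
  have h := (Matrix.isUnit_iff_isUnit_det _).mp (isUnit_one_sub_TD_mul_TA hinv hnb t)
  rw [Matrix.mul_assoc, (UA_mul_eq_iter_mul hinv hnb (z := 1) (by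
    rw [Matrix.mul_nonsing_inv_cancel_left _ _ h, Matrix.mul_one])).1, Matrix.mul_one]

end NARE

/-! ### Convergence to the stabilizing solution -/

theorem exists_pos_add_mul_add_lt_one {a b : ℝ} (h : a * b < 1) :
    ∃ ε > 0, (a + ε) * (b + ε) < 1 := by
  have hc : Tendsto (fun ε : ℝ => (a + ε) * (b + ε)) (𝓝[>] 0) (𝓝 ((a + 0) * (b + 0))) :=
    ((by fun_prop : Continuous fun ε : ℝ => (a + ε) * (b + ε)).tendsto 0).mono_left
      nhdsWithin_le_nhds
  obtain ⟨ε, h₁, h₂⟩ := ((hc.eventually_lt_const (by simpa using h)).and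
    self_mem_nhdsWithin).exists
  exact ⟨ε, h₂, h₁⟩

/-- A consequence of Gelfand's formula. -/
theorem eventually_norm_pow_le_of_spectralRadius_lt {R : Type*} [NormedRing R] [NormedAlgebra ℂ R]
    [CompleteSpace R] {a : R} {r : ℝ} (h : spectralRadius ℂ a < ENNReal.ofReal r) :
    ∀ᶠ t : ℕ in atTop, ‖a ^ t‖ ≤ r ^ t := by
  have hr : 0 < r := ENNReal.ofReal_pos.mp (bot_le.trans_lt h)
  filter_upwards [(spectrum.pow_norm_pow_one_div_tendsto_nhds_spectralRadius a).eventually_lt_const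
    h, eventually_ge_atTop 1] with t ht h1
  rw [ENNReal.ofReal_lt_ofReal_iff hr] at ht
  calc ‖a ^ t‖ = (‖a ^ t‖ ^ (1 / t : ℝ)) ^ t := by
        rw [one_div, Real.rpow_inv_natCast_pow (norm_nonneg _) (by omega)]
    _ ≤ r ^ t := by gcongr

theorem summable_norm_pow_mul_norm_pow {R S : Type*} [NormedRing R] [NormedAlgebra ℂ R]
    [CompleteSpace R] [Nontrivial R] [NormedRing S] [NormedAlgebra ℂ S] [CompleteSpace S]
    [Nontrivial S] {a : R} {b : S}
    (h : ∀ μ ∈ spectrum ℂ a, ∀ ν ∈ spectrum ℂ b, ‖μ‖ * ‖ν‖ < 1) :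
    Summable fun t : ℕ => ‖a ^ t‖ * ‖b ^ t‖ := by
  obtain ⟨μ, hμ, hμa⟩ := spectrum.exists_nnnorm_eq_spectralRadius a
  obtain ⟨ν, hν, hνb⟩ := spectrum.exists_nnnorm_eq_spectralRadius b
  obtain ⟨ε, hε, hlt⟩ := exists_pos_add_mul_add_lt_one (h μ hμ ν hν)
  have key : ∀ z : ℂ, (‖z‖₊ : ENNReal) < ENNReal.ofReal (‖z‖ + ε) := fun z => by
    rw [← enorm_eq_nnnorm, ← ofReal_norm, ENNReal.ofReal_lt_ofReal_iff (by positivity)]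
    linarith
  refine Summable.of_norm_bounded_eventually_nat
    (summable_geometric_of_lt_one (by positivity) hlt) ?_
  filter_upwards [eventually_norm_pow_le_of_spectralRadius_lt (hμa ▸ key μ),
    eventually_norm_pow_le_of_spectralRadius_lt (hνb ▸ key ν)] with t h₁ h₂
  rw [Real.norm_of_nonneg (by positivity), mul_pow]
  gcongr

theorem Matrix.mem_spectrum_iff_exists_mulVec {k : Type*} [Fintype k] [DecidableEq k]
    {M : Matrix k k ℂ} {μ : ℂ} : μ ∈ spectrum ℂ M ↔ ∃ v ≠ 0, M *ᵥ v = μ • v := by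
  rw [spectrum.mem_iff, Matrix.isUnit_iff_isUnit_det, isUnit_iff_ne_zero, not_not,
    ← Matrix.exists_mulVec_eq_zero_iff]
  simp only [Matrix.sub_mulVec, Algebra.algebraMap_eq_smul_one, Matrix.smul_mulVec, Matrix.one_mulVec,
    sub_eq_zero, eq_comm]

attribute [local instance] Matrix.linftyOpNormedAddCommGroup in
theorem Matrix.norm_entry_le_linfty_opNorm {k l : ℕ} (M : Matrix (Fin k) (Fin l) ℂ) (i : Fin k)
    (j : Fin l) : ‖M i j‖ ≤ ‖M‖ := by
  rw [Matrix.linfty_opNorm_def, ← coe_nnnorm, NNReal.coe_le_coe]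
  exact (Finset.single_le_sum (f := fun j => ‖M i j‖₊) (fun _ _ => zero_le)
    (Finset.mem_univ j)).trans (Finset.le_sup (f := fun i => ∑ j, ‖M i j‖₊) (Finset.mem_univ i))

theorem exists_eq_cayleyNum_of_mem_spectrum_cayley {k : ℕ} {α β μ : ℂ}
    {M : Matrix (Fin k) (Fin k) ℂ} (h : IsUnit (α • (1 : Matrix (Fin k) (Fin k) ℂ) + M))
    (hμ : μ ∈ spectrum ℂ (cayley α β M)) : ∃ lam ∈ spectrum ℂ M, μ = cayleyNum α β lam := by
  obtain ⟨v, hv0, hv⟩ := Matrix.mem_spectrum_iff_exists_mulVec.mp hμ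
  -- `M` commutes with `T`, hence has an eigenvector in the kernel of `T`.
  set T : Matrix (Fin k) (Fin k) ℂ := (β • 1 - M) - μ • (α • 1 + M) with hT
  have hTv : T *ᵥ v = 0 := by
    have h₁ : (α • (1 : Matrix (Fin k) (Fin k) ℂ) + M) * cayley α β M = β • 1 - M := by
      rw [cayley, Matrix.mul_nonsing_inv_cancel_left _ _ ((Matrix.isUnit_iff_isUnit_det _).mp h)]
    rw [hT, ← h₁, Matrix.sub_mulVec, ← Matrix.mulVec_mulVec, hv, Matrix.mulVec_smul,
      Matrix.smul_mulVec, sub_self]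
  have hTM : M * T = T * M := by
    simp only [hT, Matrix.mul_sub, Matrix.sub_mul, Matrix.mul_add, Matrix.add_mul,
      Matrix.mul_smul, Matrix.smul_mul, Matrix.one_mul, Matrix.mul_one]
  have hinv : ∀ w ∈ LinearMap.ker T.mulVecLin, M.mulVecLin w ∈ LinearMap.ker T.mulVecLin := by
    intro w hw
    simp only [LinearMap.mem_ker, Matrix.mulVecLin_apply, Matrix.mulVec_mulVec] at hw ⊢
    rw [← hTM, ← Matrix.mulVec_mulVec, hw, Matrix.mulVec_zero]
  have : Nontrivial (LinearMap.ker T.mulVecLin) :=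
    ⟨⟨⟨v, hTv⟩, 0, fun h => hv0 (congrArg Subtype.val h)⟩⟩
  obtain ⟨lam, hlam⟩ := Module.End.exists_eigenvalue (M.mulVecLin.restrict hinv)
  obtain ⟨w, hw, hw0⟩ := hlam.exists_hasEigenvector
  have hw₀ : (w : Fin k → ℂ) ≠ 0 := fun h => hw0 (Subtype.ext h)
  have hMw : M *ᵥ (w : Fin k → ℂ) = lam • (w : Fin k → ℂ) :=
    congrArg Subtype.val (Module.End.mem_eigenspace_iff.mp hw)
  have hTw : T *ᵥ (w : Fin k → ℂ) = 0 := w.2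
  have hne : α + lam ≠ 0 := fun h0 => hw₀ <| by
    have h₁ := Matrix.mulVec_injective_of_isUnit h
    apply h₁
    rw [Matrix.add_mulVec, hMw, Matrix.smul_mulVec, Matrix.one_mulVec, ← add_smul, h0, zero_smul,
      Matrix.mulVec_zero]
  refine ⟨lam, Matrix.mem_spectrum_iff_exists_mulVec.mpr ⟨w, hw₀, hMw⟩, ?_⟩
  have hs : ((β - lam) - μ * (α + lam)) • (w : Fin k → ℂ) = 0 := by
    rw [← hTw]
    simp only [hT, Matrix.sub_mulVec, Matrix.add_mulVec, Matrix.smul_mulVec, Matrix.one_mulVec, hMw,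
      sub_smul, mul_smul, add_smul]
  have h₂ := (smul_eq_zero.mp hs).resolve_right hw₀
  rw [cayleyNum, eq_inv_mul_iff_mul_eq₀ hne]
  linear_combination -h₂

/-- A block matrix whose leading block and Schur complement are nonsingular has trivial kernel. -/
theorem Matrix.eq_zero_of_schur {k l : ℕ} {P : Matrix (Fin l) (Fin l) ℂ}
    {Q : Matrix (Fin k) (Fin k) ℂ} {B : Matrix (Fin k) (Fin l) ℂ} {C : Matrix (Fin l) (Fin k) ℂ}
    {v : Fin l → ℂ} {w : Fin k → ℂ} (hP : IsUnit P) (hQ : IsUnit (Q - B * P⁻¹ * C))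
    (h₁ : P *ᵥ v = C *ᵥ w) (h₂ : Q *ᵥ w = B *ᵥ v) : v = 0 := by
  have hP' := (Matrix.isUnit_iff_isUnit_det _).mp hP
  have hv : v = P⁻¹ *ᵥ (C *ᵥ w) := by
    rw [← h₁, Matrix.mulVec_mulVec, Matrix.nonsing_inv_mul _ hP', Matrix.one_mulVec]
  have hw : w = 0 := by
    apply Matrix.mulVec_injective_of_isUnit hQ
    rw [Matrix.sub_mulVec, h₂, Matrix.mulVec_zero, hv]
    simp only [Matrix.mulVec_mulVec, Matrix.mul_assoc, sub_self]
  rw [hv, hw, Matrix.mulVec_zero, Matrix.mulVec_zero]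

theorem Matrix.isUnit_of_mulVec_eq_zero {k : ℕ} {M : Matrix (Fin k) (Fin k) ℂ}
    (h : ∀ v, M *ᵥ v = 0 → v = 0) : IsUnit M := by
  rw [← Matrix.mulVec_injective_iff_isUnit]
  exact (injective_iff_map_eq_zero M.mulVecLin).mpr h

namespace NARE

variable {m n p q : ℕ} {N : NARE m n p q} {α β : ℂ}
  {X : Matrix (Fin m) (Fin n) ℂ} {Y : Matrix (Fin n) (Fin m) ℂ}

/-- The graph `[I; X]` is invariant under the linearizing matrix, which acts on it as `D - C X`; this
is the second block row, the first one being an identity. -/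
theorem invariance_of_solution (hX : X * N.C * X - X * N.D - N.A * X + N.B = 0) :
    N.B - N.A * X = X * (N.D - N.C * X) := by
  rw [Matrix.mul_sub, ← Matrix.mul_assoc, ← sub_eq_zero, ← hX]
  abel

/-- The graph `[Y; I]` is invariant under the linearizing matrix, which acts on it as `-(A - B Y)`. -/
theorem invariance_of_dual_solution (hY : Y * N.B * Y - Y * N.A - N.D * Y + N.C = 0) :
    N.C - N.D * Y = Y * (N.A - N.B * Y) := by
  rw [Matrix.mul_sub, ← Matrix.mul_assoc, ← sub_eq_zero, ← hY]
  abel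

theorem spectrum_subset_of_solution (hX : X * N.C * X - X * N.D - N.A * X + N.B = 0) :
    spectrum ℂ (N.D - N.C * X) ⊆ spectrum ℂ N.H := by
  intro μ hμ
  obtain ⟨v, hv0, hv⟩ := Matrix.mem_spectrum_iff_exists_mulVec.mp hμ
  refine Matrix.mem_spectrum_iff_exists_mulVec.mpr ⟨Sum.elim v (X *ᵥ v), ?_, ?_⟩
  · exact fun h => hv0 (funext fun i => congrFun h (Sum.inl i))
  · have h₂ := congrArg (· *ᵥ v) (invariance_of_solution hX)
    simp only [← Matrix.mulVec_mulVec, hv, Matrix.mulVec_smul] at h₂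
    rw [H, Matrix.fromBlocks_mulVec, Sum.elim_comp_inl, Sum.elim_comp_inr]
    have h₃ : N.D *ᵥ v + -N.C *ᵥ X *ᵥ v = μ • v := by
      rw [← hv, Matrix.sub_mulVec, Matrix.neg_mulVec, Matrix.mulVec_mulVec, sub_eq_add_neg]
    have h₄ : N.B *ᵥ v + -N.A *ᵥ X *ᵥ v = μ • X *ᵥ v := by
      rw [← h₂, Matrix.sub_mulVec, Matrix.neg_mulVec, Matrix.mulVec_mulVec, sub_eq_add_neg]
    rw [h₃, h₄]
    ext (i | i) <;> rfl

theorem neg_mem_spectrum_of_dual_solution (hY : Y * N.B * Y - Y * N.A - N.D * Y + N.C = 0)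
    {μ : ℂ} (hμ : μ ∈ spectrum ℂ (N.A - N.B * Y)) : -μ ∈ spectrum ℂ N.H := by
  obtain ⟨v, hv0, hv⟩ := Matrix.mem_spectrum_iff_exists_mulVec.mp hμ
  refine Matrix.mem_spectrum_iff_exists_mulVec.mpr ⟨Sum.elim (Y *ᵥ v) v, ?_, ?_⟩
  · exact fun h => hv0 (funext fun i => congrFun h (Sum.inr i))
  · have h₂ := congrArg (· *ᵥ v) (invariance_of_dual_solution hY)
    simp only [← Matrix.mulVec_mulVec, hv, Matrix.mulVec_smul] at h₂
    rw [H, Matrix.fromBlocks_mulVec, Sum.elim_comp_inl, Sum.elim_comp_inr]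
    have h₃ : N.D *ᵥ Y *ᵥ v + -N.C *ᵥ v = -μ • Y *ᵥ v := by
      rw [neg_smul, ← h₂, Matrix.sub_mulVec, Matrix.neg_mulVec, Matrix.mulVec_mulVec]
      abel
    have h₄ : N.B *ᵥ Y *ᵥ v + -N.A *ᵥ v = -μ • v := by
      rw [neg_smul, ← hv, Matrix.sub_mulVec, Matrix.neg_mulVec, Matrix.mulVec_mulVec]
      abel
    rw [h₃, h₄]
    ext (i | i) <;> rfl

/-- Nonsingularity of `α I + H` passes to its restriction to the graph of `X`. -/
theorem isUnit_add_of_solution (hinv : N.ShiftsInvertible α β)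
    (hX : X * N.C * X - X * N.D - N.A * X + N.B = 0) :
    IsUnit (α • (1 : Matrix (Fin n) (Fin n) ℂ) + (N.D - N.C * X)) := by
  refine Matrix.isUnit_of_mulVec_eq_zero fun v hv => ?_
  have hR : (N.D - N.C * X) *ᵥ v = -(α • v) := by
    rw [Matrix.add_mulVec, Matrix.smul_mulVec, Matrix.one_mulVec] at hv
    exact eq_neg_of_add_eq_zero_right hv
  have h₂ := congrArg (· *ᵥ v) (invariance_of_solution hX)
  simp only [← Matrix.mulVec_mulVec, hR, Matrix.mulVec_neg, Matrix.mulVec_smul,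
    Matrix.sub_mulVec] at h₂
  refine Matrix.eq_zero_of_schur (w := X *ᵥ v) hinv.1 hinv.2.2.2.1 ?_ ?_
  · rw [Matrix.sub_mulVec, ← Matrix.mulVec_mulVec, sub_eq_iff_eq_add] at hR
    rw [Ds, Matrix.add_mulVec, Matrix.smul_mulVec, Matrix.one_mulVec, hR]
    abel
  · rw [As, Matrix.add_mulVec, Matrix.smul_mulVec, Matrix.one_mulVec, neg_smul, ← h₂]
    abel

/-- Nonsingularity of `β I - H` passes to its restriction to the graph `[Y; I]`. -/
theorem isUnit_add_of_dual_solution (hinv : N.ShiftsInvertible α β)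
    (hY : Y * N.B * Y - Y * N.A - N.D * Y + N.C = 0) :
    IsUnit (β • (1 : Matrix (Fin m) (Fin m) ℂ) + (N.A - N.B * Y)) := by
  refine Matrix.isUnit_of_mulVec_eq_zero fun v hv => ?_
  have hS : (N.A - N.B * Y) *ᵥ v = -(β • v) := by
    rw [Matrix.add_mulVec, Matrix.smul_mulVec, Matrix.one_mulVec] at hv
    exact eq_neg_of_add_eq_zero_right hv
  have h₂ := congrArg (· *ᵥ v) (invariance_of_dual_solution hY)
  simp only [← Matrix.mulVec_mulVec, hS, Matrix.mulVec_neg, Matrix.mulVec_smul,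
    Matrix.sub_mulVec] at h₂
  refine Matrix.eq_zero_of_schur (w := Y *ᵥ v) hinv.2.1 hinv.2.2.2.2 ?_ ?_
  · rw [Matrix.sub_mulVec, ← Matrix.mulVec_mulVec, sub_eq_iff_eq_add] at hS
    rw [As, Matrix.add_mulVec, Matrix.smul_mulVec, Matrix.one_mulVec, hS]
    abel
  · rw [Ds, Matrix.add_mulVec, Matrix.smul_mulVec, Matrix.one_mulVec, neg_smul, ← h₂]
    abel

theorem Step.sub {r : ℕ} {u₁ u₁' u₂ u₂' : Matrix (Fin n) (Fin r) ℂ}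
    {v₁ v₁' v₂ v₂' : Matrix (Fin m) (Fin r) ℂ} (h₁ : N.Step α β u₁ u₁' v₁ v₁')
    (h₂ : N.Step α β u₂ u₂' v₂ v₂') :
    N.Step α β (u₁ - u₂) (u₁' - u₂') (v₁ - v₂) (v₁' - v₂') := by
  constructor
  · rw [Matrix.mul_sub, h₁.1, h₂.1]
    simp only [Matrix.mul_sub, Matrix.mul_add]
    abel
  · rw [Matrix.mul_sub, h₁.2, h₂.2]
    simp only [Matrix.mul_sub, Matrix.mul_add]
    abel

/-- On the graph of `X` the recurrence is solved backwards in time by powers of the Cayley transform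
of `D - C X`. -/
theorem Step.of_solution {r : ℕ} (hinv : N.ShiftsInvertible α β)
    (hX : X * N.C * X - X * N.D - N.A * X + N.B = 0) (z : Matrix (Fin n) (Fin r) ℂ) :
    N.Step α β (cayley α β (N.D - N.C * X) * z) z
      (X * (cayley α β (N.D - N.C * X) * z)) (X * z) := by
  have h := cayley_mul (β := β) (isUnit_add_of_solution hinv hX) z
  have hXR := invariance_of_solution hX
  set w := cayley α β (N.D - N.C * X) * z
  constructor
  · rw [← sub_eq_zero] at h ⊢
    rw [← h]
    simp only [Ds, Matrix.add_mul, Matrix.sub_mul, Matrix.mul_add, Matrix.smul_mul,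
      Matrix.one_mul, neg_smul, Matrix.mul_assoc, Matrix.neg_mul]
    abel
  · have h' : α • (X * w) + (N.B - N.A * X) * w = β • (X * z) - (N.B - N.A * X) * z := by
      rw [hXR]
      simpa only [Matrix.add_mul, Matrix.sub_mul, Matrix.mul_add, Matrix.mul_sub, Matrix.smul_mul,
        Matrix.mul_smul, Matrix.one_mul, Matrix.mul_assoc] using congrArg (X * ·) h
    rw [← sub_eq_zero] at h' ⊢
    rw [← neg_eq_zero]
    rw [← h']
    simp only [As, Matrix.add_mul, Matrix.sub_mul, Matrix.mul_add, Matrix.smul_mul,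
      Matrix.one_mul, neg_smul, Matrix.mul_assoc, Matrix.neg_mul]
    abel

/-- On the graph `[Y; I]` the recurrence is solved forwards in time by powers of the Cayley transform
of `A - B Y`. -/
theorem Step.of_dual_solution {r : ℕ} (hinv : N.ShiftsInvertible α β)
    (hY : Y * N.B * Y - Y * N.A - N.D * Y + N.C = 0) (z : Matrix (Fin m) (Fin r) ℂ) :
    N.Step α β (Y * z) (Y * (cayley β α (N.A - N.B * Y) * z))
      z (cayley β α (N.A - N.B * Y) * z) := by
  have h := cayley_mul (β := α) (isUnit_add_of_dual_solution hinv hY) z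
  have hYS := invariance_of_dual_solution hY
  set w := cayley β α (N.A - N.B * Y) * z
  constructor
  · have h' : β • (Y * w) + (N.C - N.D * Y) * w = α • (Y * z) - (N.C - N.D * Y) * z := by
      rw [hYS]
      simpa only [Matrix.add_mul, Matrix.sub_mul, Matrix.mul_add, Matrix.mul_sub, Matrix.smul_mul,
        Matrix.mul_smul, Matrix.one_mul, Matrix.mul_assoc] using congrArg (Y * ·) h
    rw [← sub_eq_zero] at h' ⊢
    rw [← neg_eq_zero]
    rw [← h']
    simp only [Ds, Matrix.add_mul, Matrix.sub_mul, Matrix.mul_add, Matrix.smul_mul,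
      Matrix.one_mul, neg_smul, Matrix.mul_assoc, Matrix.neg_mul]
    abel
  · rw [← sub_eq_zero] at h ⊢
    rw [← h]
    simp only [As, Matrix.add_mul, Matrix.sub_mul, Matrix.mul_add, Matrix.smul_mul,
      Matrix.one_mul, neg_smul, Matrix.mul_assoc, Matrix.neg_mul]
    abel

/-- The relation `X_t (I - Y Q_t) = X - Q_t`, where `Q_t = Γ^t X Λ^t` with `Γ` and `Λ` the Cayley
transforms of `A - B Y` and `D - C X`. It compares `X_t` with the trajectory that is the
difference of one on the graph of `X` and one on the graph `[Y; I]`, chosen so that the second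
component vanishes at time zero. -/
theorem iter_mul_one_sub (hinv : N.ShiftsInvertible α β) (hnb : N.NoBreakdown α β)
    (hX : X * N.C * X - X * N.D - N.A * X + N.B = 0)
    (hY : Y * N.B * Y - Y * N.A - N.D * Y + N.C = 0) (t : ℕ) :
    N.iter α β t * (1 - Y * (cayley β α (N.A - N.B * Y) ^ t * X *
      cayley α β (N.D - N.C * X) ^ t)) =
    X - cayley β α (N.A - N.B * Y) ^ t * X * cayley α β (N.D - N.C * X) ^ t := by
  set Λ := cayley α β (N.D - N.C * X) with hΛ
  set Γ := cayley β α (N.A - N.B * Y) with hΓ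
  have h := (eq_iter_mul_of_steps (t := t) (U := fun j => Λ ^ j - Y * (Γ ^ (t - j) * (X * Λ ^ t)))
    (V := fun j => X * Λ ^ j - Γ ^ (t - j) * (X * Λ ^ t)) hinv hnb (by simp) (fun j hj => by
      refine Step.sub ?_ ?_
      · simpa only [← hΛ, pow_succ'] using Step.of_solution hinv hX (Λ ^ j)
      · have h := Step.of_dual_solution hinv hY (Γ ^ (t - (j + 1)) * (X * Λ ^ t))
        rwa [← hΓ, ← Matrix.mul_assoc Γ, ← pow_succ', show t - (j + 1) + 1 = t - j by omega]
          at h)).1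
  simpa [Matrix.mul_assoc] using h.symm

theorem norm_mul_norm_lt_one_of_mem_spectrum (hinv : N.ShiftsInvertible α β)
    (hsep : N.Separated α β) (hX : N.IsStabilizing X) (hY : N.IsWeaklyDualStabilizing Y)
    {μ ν : ℂ} (hμ : μ ∈ spectrum ℂ (cayley β α (N.A - N.B * Y)))
    (hν : ν ∈ spectrum ℂ (cayley α β (N.D - N.C * X))) : ‖μ‖ * ‖ν‖ < 1 := by
  obtain ⟨l, hl, rfl⟩ := exists_eq_cayleyNum_of_mem_spectrum_cayley
    (isUnit_add_of_dual_solution hinv hY.1) hμ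
  obtain ⟨k, hk, rfl⟩ := exists_eq_cayleyNum_of_mem_spectrum_cayley
    (isUnit_add_of_solution hinv hX.1) hν
  have h := hsep k (spectrum_subset_of_solution hX.1 hk) (hX.2 k hk) (-l)
    (neg_mem_spectrum_of_dual_solution hY.1 hl) (by simpa using hY.2 l hl)
  have hl' : (cayleyNum α β (-l))⁻¹ = cayleyNum β α l := by
    rw [cayleyNum, cayleyNum, mul_inv, inv_inv, mul_comm]
    simp [sub_eq_add_neg]
  rw [hl', norm_inv] at h
  have hpos : 0 < ‖cayleyNum α β k‖ := inv_pos.mp ((norm_nonneg _).trans_lt h)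
  calc _ < ‖cayleyNum α β k‖⁻¹ * ‖cayleyNum α β k‖ := by gcongr
    _ = 1 := inv_mul_cancel₀ hpos.ne'

section Norm

attribute [local instance] Matrix.linftyOpNormedAddCommGroup Matrix.linftyOpNormedRing
  Matrix.linftyOpNormedAlgebra

/-- The errors are summable: once `‖Y Q_t‖ ≤ 1/2`, the relation `X_t (I - Y Q_t) = X - Q_t` bounds
them by a constant times `‖Q_t‖`, which decays geometrically. -/
theorem summable_norm_iter_sub (hinv : N.ShiftsInvertible α β) (hsep : N.Separated α β)
    (hnb : N.NoBreakdown α β) (hX : N.IsStabilizing X) (hY : N.IsWeaklyDualStabilizing Y)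
    (i : Fin m) (j : Fin n) : Summable fun t => ‖N.iter α β t i j - X i j‖ := by
  have : Nonempty (Fin m) := ⟨i⟩
  have : Nonempty (Fin n) := ⟨j⟩
  have hs := summable_norm_pow_mul_norm_pow fun μ hμ ν hν =>
    norm_mul_norm_lt_one_of_mem_spectrum hinv hsep hX hY (μ := μ) (ν := ν) hμ hν
  set Q : ℕ → Matrix (Fin m) (Fin n) ℂ := fun t =>
    cayley β α (N.A - N.B * Y) ^ t * X * cayley α β (N.D - N.C * X) ^ t with hQ
  have hQs : Summable fun t => ‖Q t‖ := by
    refine (hs.mul_left ‖X‖).of_nonneg_of_le (fun _ => norm_nonneg _) fun t => ?_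
    calc ‖Q t‖ ≤ ‖cayley β α (N.A - N.B * Y) ^ t * X‖ * ‖cayley α β (N.D - N.C * X) ^ t‖ :=
          Matrix.linfty_opNorm_mul _ _
      _ ≤ ‖cayley β α (N.A - N.B * Y) ^ t‖ * ‖X‖ * ‖cayley α β (N.D - N.C * X) ^ t‖ := by
          gcongr
          exact Matrix.linfty_opNorm_mul _ _
      _ = _ := by ring
  have hsmall : ∀ᶠ t in atTop, ‖Y‖ * ‖Q t‖ ≤ 1 / 2 := by
    have h := hQs.tendsto_atTop_zero.const_mul ‖Y‖
    rw [mul_zero] at h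
    exact h.eventually_le_const (by norm_num)
  refine Summable.of_norm_bounded_eventually_nat (hQs.mul_left (2 * (‖X‖ * ‖Y‖ + 1))) ?_
  filter_upwards [hsmall] with t ht
  rw [norm_norm]
  refine (Matrix.norm_entry_le_linfty_opNorm (N.iter α β t - X) i j).trans ?_
  have hrel := iter_mul_one_sub hinv hnb hX.1 hY.1 t
  change N.iter α β t * (1 - Y * Q t) = X - Q t at hrel
  -- With `‖Y Q_t‖ ≤ 1/2` the first summand is absorbed by the left-hand side.
  have heq : N.iter α β t - X = (N.iter α β t - X) * (Y * Q t) + (X * (Y * Q t) - Q t) := by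
    rw [Matrix.mul_sub, Matrix.mul_one, sub_eq_iff_eq_add] at hrel
    rw [Matrix.sub_mul]
    nth_rewrite 1 [hrel]
    abel
  have hYQ : ‖Y * Q t‖ ≤ ‖Y‖ * ‖Q t‖ := Matrix.linfty_opNorm_mul _ _
  have hb : ‖N.iter α β t - X‖ ≤ ‖N.iter α β t - X‖ * (1 / 2) + (‖X‖ * (‖Y‖ * ‖Q t‖) + ‖Q t‖) := by
    calc ‖N.iter α β t - X‖ ≤ ‖(N.iter α β t - X) * (Y * Q t)‖ + (‖X * (Y * Q t)‖ + ‖Q t‖) := by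
          nth_rewrite 1 [heq]
          exact (norm_add_le _ _).trans (by gcongr; exact norm_sub_le _ _)
      _ ≤ _ := by
          gcongr
          · exact (Matrix.linfty_opNorm_mul _ _).trans (by gcongr; exact hYQ.trans ht)
          · exact (Matrix.linfty_opNorm_mul _ _).trans (by gcongr)
  linarith

end Norm

theorem tendsto_iter (hinv : N.ShiftsInvertible α β) (hsep : N.Separated α β)
    (hnb : N.NoBreakdown α β) (hX : N.IsStabilizing X) (hY : N.IsWeaklyDualStabilizing Y) :
    Tendsto (fun t => N.iter α β t) atTop (𝓝 X) := by
  refine tendsto_pi_nhds.mpr fun i => tendsto_pi_nhds.mpr fun j => ?_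
  exact tendsto_iff_norm_sub_tendsto_zero.mpr
    (summable_norm_iter_sub hinv hsep hnb hX hY i j).tendsto_atTop_zero

theorem hasSum_iter_succ_sub (hinv : N.ShiftsInvertible α β) (hsep : N.Separated α β)
    (hnb : N.NoBreakdown α β) (hX : N.IsStabilizing X) (hY : N.IsWeaklyDualStabilizing Y) :
    HasSum (fun t => N.iter α β (t + 1) - N.iter α β t) X := by
  refine Pi.hasSum.mpr fun i => Pi.hasSum.mpr fun j => ?_
  have hs := summable_norm_iter_sub hinv hsep hnb hX hY i j
  have hsum : Summable fun t => N.iter α β (t + 1) i j - N.iter α β t i j := by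
    refine Summable.of_norm_bounded (((summable_nat_add_iff 1).mpr hs).add hs) fun t => ?_
    rw [← sub_sub_sub_cancel_right _ _ (X i j)]
    exact norm_sub_le _ _
  refine (hsum.hasSum_iff_tendsto_nat).mpr ?_
  have ht : Tendsto (fun t => N.iter α β t i j) atTop (𝓝 (X i j)) :=
    tendsto_iff_norm_sub_tendsto_zero.mpr hs.tendsto_atTop_zero
  refine ht.congr fun t => ?_
  rw [Finset.sum_range_sub (fun t => N.iter α β t i j)]
  simp [iter]

end NARE

/-! ### Infinite matrices and block triangular factorization -/

/-- The inclusion of the first `t` blocks of indices into all of them. -/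
def leadIndex {t a : ℕ} (k : Fin t × Fin a) : ℕ × Fin a := (k.1, k.2)

theorem leadIndex_injective {t a : ℕ} : Function.Injective (leadIndex : Fin t × Fin a → ℕ × Fin a) :=
  fun _ _ h => Prod.ext (Fin.ext (congrArg Prod.fst h)) (Prod.ext_iff.mp h).2

/-- The leading `t × t` blocks of an infinite block matrix. -/
def trunc {a b : ℕ} (t : ℕ) (M : Matrix (ℕ × Fin a) (ℕ × Fin b) ℂ) :
    Matrix (Fin t × Fin a) (Fin t × Fin b) ℂ :=
  M.submatrix leadIndex leadIndex

/-- The infinite block matrix with leading blocks `P` and zeros elsewhere. -/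
def zeroExtend {a b t : ℕ} (P : Matrix (Fin t × Fin a) (Fin t × Fin b) ℂ) :
    Matrix (ℕ × Fin a) (ℕ × Fin b) ℂ :=
  Matrix.of fun i j =>
    if h : i.1 < t ∧ j.1 < t then P (⟨i.1, h.1⟩, i.2) (⟨j.1, h.2⟩, j.2) else 0

section Truncation

variable {a b c : ℕ} {I J : Type*}

theorem infMul_apply_eq_sum (t : ℕ) {M : Matrix I (ℕ × Fin a) ℂ} {N : Matrix (ℕ × Fin a) J ℂ}
    {i : I} {j : J} (h : ∀ k : ℕ × Fin a, t ≤ k.1 → M i k * N k j = 0) :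
    infMul M N i j = ∑ k : Fin t × Fin a, M i (leadIndex k) * N (leadIndex k) j := by
  rw [infMul, Matrix.of_apply,
    finsum_eq_sum_of_support_subset (s := Finset.univ.image (leadIndex : Fin t × Fin a → _)),
    Finset.sum_image leadIndex_injective.injOn]
  intro k hk
  have hkt : k.1 < t := not_le.mp fun hle => hk (h k hle)
  simpa using ⟨⟨k.1, hkt⟩, k.2, rfl⟩

theorem submatrix_infMul_of_isBlockLower {J' : Type*} {M : Matrix (ℕ × Fin a) (ℕ × Fin b) ℂ}
    (hM : IsBlockLower M) (N : Matrix (ℕ × Fin b) J ℂ) (t : ℕ) (g : J' → J) :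
    (infMul M N).submatrix leadIndex g =
      trunc t M * (N.submatrix leadIndex g : Matrix (Fin t × Fin b) J' ℂ) := by
  ext i j
  refine (infMul_apply_eq_sum t fun k hk => ?_).trans rfl
  exact mul_eq_zero_of_left (hM i.1 k.1 i.2 k.2 (i.1.2.trans_le hk)) _

theorem submatrix_infMul_of_isBlockUpper {I' : Type*} (M : Matrix I (ℕ × Fin a) ℂ)
    {N : Matrix (ℕ × Fin a) (ℕ × Fin b) ℂ} (hN : IsBlockUpper N) (t : ℕ) (f : I' → I) :
    (infMul M N).submatrix f leadIndex =
      (M.submatrix f leadIndex : Matrix I' (Fin t × Fin a) ℂ) * trunc t N := by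
  ext i j
  refine (infMul_apply_eq_sum t fun k hk => ?_).trans rfl
  exact mul_eq_zero_of_right _ (hN k.1 j.1 k.2 j.2 (j.1.2.trans_le hk))

theorem trunc_infMul_of_isBlockLower {M : Matrix (ℕ × Fin a) (ℕ × Fin b) ℂ}
    (hM : IsBlockLower M) (N : Matrix (ℕ × Fin b) (ℕ × Fin c) ℂ) (t : ℕ) :
    trunc t (infMul M N) = trunc t M * trunc t N :=
  submatrix_infMul_of_isBlockLower hM N t _

theorem trunc_one (t : ℕ) : trunc t (1 : Matrix (ℕ × Fin a) (ℕ × Fin a) ℂ) = 1 :=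
  Matrix.submatrix_one _ leadIndex_injective

/-- Identities between infinite matrices may be checked on all leading truncations. -/
theorem eq_of_trunc_eq {M N : Matrix (ℕ × Fin a) (ℕ × Fin b) ℂ}
    (h : ∀ t, trunc t M = trunc t N) : M = N := by
  ext i j
  exact congrFun (congrFun (h (max i.1 j.1 + 1)) (⟨i.1, by omega⟩, i.2)) (⟨j.1, by omega⟩, j.2)

theorem trunc_zeroExtend {t : ℕ} (P : Matrix (Fin t × Fin a) (Fin t × Fin b) ℂ) :
    trunc t (zeroExtend P) = P := by
  ext i j
  simp [trunc, zeroExtend, leadIndex]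

/-- For block lower triangular matrices, inverting commutes with truncating. -/
theorem IsBlockLower.trunc_zeroExtend_inv {M : Matrix (ℕ × Fin a) (ℕ × Fin a) ℂ} (hM : IsBlockLower M)
    {s t : ℕ} (hst : s ≤ t) (hu : IsUnit (trunc t M)) :
    trunc s (zeroExtend (trunc t M)⁻¹) = (trunc s M)⁻¹ := by
  refine (Matrix.inv_eq_right_inv ?_).symm
  have h : trunc t (infMul M (zeroExtend (trunc t M)⁻¹)) = trunc t 1 := by
    rw [trunc_infMul_of_isBlockLower hM, trunc_zeroExtend, trunc_one,
      Matrix.mul_nonsing_inv _ ((Matrix.isUnit_iff_isUnit_det _).mp hu)]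
  rw [← trunc_infMul_of_isBlockLower hM, ← trunc_one]
  ext i j
  exact congrFun (congrFun h (i.1.castLE hst, i.2)) (j.1.castLE hst, j.2)

theorem IsBlockLower.exists_inverse {M : Matrix (ℕ × Fin a) (ℕ × Fin a) ℂ} (hM : IsBlockLower M)
    (hu : ∀ t, IsUnit (trunc t M)) :
    ∃ M', IsBlockLower M' ∧ infMul M M' = 1 ∧ infMul M' M = 1 := by
  have hd := fun t => (Matrix.isUnit_iff_isUnit_det _).mp (hu t)
  -- Entry `(i, j)` is read off the inverse of any truncation large enough to contain it.
  set M' : Matrix (ℕ × Fin a) (ℕ × Fin a) ℂ :=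
    Matrix.of fun i j => zeroExtend (trunc (max i.1 j.1 + 1) M)⁻¹ i j with hM'
  have ht : ∀ t, trunc t M' = (trunc t M)⁻¹ := by
    intro t
    ext i j
    have hs : max (i.1 : ℕ) (j.1 : ℕ) + 1 ≤ t := by omega
    have h₁ := hM.trunc_zeroExtend_inv hs (hu t)
    rw [← trunc_zeroExtend (trunc (max (i.1 : ℕ) (j.1 : ℕ) + 1) M)⁻¹] at h₁
    have h₂ := congrFun (congrFun h₁ (⟨i.1, by omega⟩, i.2)) (⟨j.1, by omega⟩, j.2)
    exact h₂.symm.trans (congrFun (congrFun (trunc_zeroExtend (trunc t M)⁻¹) i) j)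
  have hlow : IsBlockLower M' := by
    intro i j x y hij
    have hb : (trunc (j + 1) M).BlockTriangular (fun k => OrderDual.toDual k.1) :=
      fun k l hkl => hM _ _ _ _ (OrderDual.toDual_lt_toDual.mp hkl)
    have := (hu (j + 1)).invertible
    have h := congrFun (congrFun (ht (j + 1)) (⟨i, by omega⟩, x)) (⟨j, by omega⟩, y)
    refine h.trans ?_
    exact Matrix.blockTriangular_inv_of_blockTriangular hb (OrderDual.toDual_lt_toDual.mpr hij)
  refine ⟨M', hlow, eq_of_trunc_eq fun t => ?_, eq_of_trunc_eq fun t => ?_⟩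
  · rw [trunc_infMul_of_isBlockLower hM, ht, trunc_one, Matrix.mul_nonsing_inv _ (hd t)]
  · rw [trunc_infMul_of_isBlockLower hlow, ht, trunc_one, Matrix.nonsing_inv_mul _ (hd t)]

theorem transpose_infMul {K : Type*} (M : Matrix I K ℂ) (N : Matrix K J ℂ) :
    (infMul M N)ᵀ = infMul Nᵀ Mᵀ := by
  ext i j
  simp [infMul, mul_comm]

theorem IsBlockUpper.exists_inverse {M : Matrix (ℕ × Fin a) (ℕ × Fin a) ℂ} (hM : IsBlockUpper M)
    (hu : ∀ t, IsUnit (trunc t M)) :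
    ∃ M', IsBlockUpper M' ∧ infMul M M' = 1 ∧ infMul M' M = 1 := by
  have hMt : IsBlockLower Mᵀ := fun i j x y hij => hM j i y x hij
  obtain ⟨M', h, h₁, h₂⟩ := hMt.exists_inverse fun t => (Matrix.isUnit_transpose _).mpr (hu t)
  refine ⟨M'ᵀ, fun i j x y hij => h j i y x hij, ?_, ?_⟩
  · rw [← Matrix.transpose_transpose M, ← transpose_infMul, h₂,
      Matrix.transpose_one]
  · rw [← Matrix.transpose_transpose M, ← transpose_infMul, h₁,
      Matrix.transpose_one]

/-- Block Gauss elimination: if all leading truncations of `W` are nonsingular, a block lower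
unitriangular `E` makes `E W` block upper triangular. -/
theorem exists_isBlockLower_infMul_isBlockUpper {W : Matrix (ℕ × Fin a) (ℕ × Fin a) ℂ}
    (hW : ∀ t, IsUnit (trunc t W)) :
    ∃ E : Matrix (ℕ × Fin a) (ℕ × Fin a) ℂ, IsBlockLower E ∧
      (∀ t, IsUnit (trunc t E)) ∧ IsBlockUpper (infMul E W) := by
  -- Subtracting the combination `e i` of the preceding rows clears row `i` left of the diagonal
  -- block.
  set e : ∀ i : ℕ × Fin a, Fin i.1 × Fin a → ℂ := fun i =>
    (fun l => W i (leadIndex l)) ᵥ* (trunc i.1 W)⁻¹ with he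
  have hcW : ∀ i, e i ᵥ* trunc i.1 W = fun l => W i (leadIndex l) := fun i => by
    rw [he, Matrix.vecMul_vecMul,
      Matrix.nonsing_inv_mul _ ((Matrix.isUnit_iff_isUnit_det _).mp (hW i.1)), Matrix.vecMul_one]
  set E : Matrix (ℕ × Fin a) (ℕ × Fin a) ℂ := Matrix.of fun i j =>
    if h : j.1 < i.1 then -e i (⟨j.1, h⟩, j.2) else (1 : Matrix _ _ ℂ) i j with hE
  have hEge : ∀ i j : ℕ × Fin a, i.1 ≤ j.1 → E i j = (1 : Matrix _ _ ℂ) i j := fun i j hij => by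
    rw [hE, Matrix.of_apply, dif_neg (not_lt.mpr hij)]
  have hlow : IsBlockLower E := fun i j x y hij => by
    rw [hEge _ _ hij.le, Matrix.one_apply_ne]
    simp [hij.ne]
  refine ⟨E, hlow, fun t => ?_, fun i j x y hij => ?_⟩
  · have hb : (trunc t E).BlockTriangular (fun k => OrderDual.toDual k.1) :=
      fun k l hkl => hlow _ _ _ _ (OrderDual.toDual_lt_toDual.mp hkl)
    rw [Matrix.isUnit_iff_isUnit_det, hb.det_fintype, Finset.prod_eq_one]
    · exact isUnit_one
    · intro k _
      have h1 : (trunc t E).toSquareBlock (fun k => OrderDual.toDual k.1) k = 1 := by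
        rw [← Matrix.submatrix_one (fun k : {k' : Fin t × Fin a // OrderDual.toDual k'.1 = k} =>
          leadIndex k.1) (leadIndex_injective.comp Subtype.val_injective)]
        ext r s
        exact hEge _ _ (le_of_eq (congrArg (fun z => ((OrderDual.ofDual z : Fin t) : ℕ))
          (r.2.trans s.2.symm)))
      rw [h1, Matrix.det_one]
  · rw [infMul_apply_eq_sum (i + 1), Fintype.sum_prod_type, Fin.sum_univ_castSucc]
    · have h := congrFun (hcW (i, x)) (⟨j, hij⟩, y)
      simp only [Matrix.vecMul, dotProduct, Fintype.sum_prod_type] at h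
      have h₁ : ∑ l : Fin i, ∑ z : Fin a, E (i, x) (leadIndex (l.castSucc, z)) *
          W (leadIndex (l.castSucc, z)) (j, y) = -W (i, x) (j, y) := by
        rw [show W (i, x) (j, y) = _ from h.symm, ← Finset.sum_neg_distrib]
        refine Finset.sum_congr rfl fun l _ => ?_
        rw [← Finset.sum_neg_distrib]
        refine Finset.sum_congr rfl fun z _ => ?_
        rw [← neg_mul]
        congr 1
        simp [hE, leadIndex]
      have h₂ : ∑ z : Fin a, E (i, x) (leadIndex (Fin.last i, z)) *
          W (leadIndex (Fin.last i, z)) (j, y) = W (i, x) (j, y) := by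
        rw [Finset.sum_eq_single x]
        · simp [hE, leadIndex]
        · intro z _ hz
          simp [hE, leadIndex, Matrix.one_apply, hz.symm]
        · simp
      rw [h₁, h₂, neg_add_cancel]
    · intro k hk
      rw [hlow _ _ _ _ (show i < k.1 from hk), zero_mul]

/-- The partial sums over the blocks of `(U R') (L' V)` are the expressions `U_t W_t⁻¹ V_t` formed
from leading truncations, because truncation is multiplicative on products with a block lower
triangular left or a block upper triangular right factor. -/
theorem hasInfiniteForm_of_hasSum {m n p : ℕ} {U : Matrix (Fin m) (ℕ × Fin p) ℂ}
    {W : Matrix (ℕ × Fin p) (ℕ × Fin p) ℂ} {V : Matrix (ℕ × Fin p) (Fin n) ℂ}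
    {X : Matrix (Fin m) (Fin n) ℂ} {S : ℕ → Matrix (Fin m) (Fin n) ℂ}
    (hW : ∀ t, IsUnit (trunc t W))
    (hS : ∀ t, S t = (U.submatrix id leadIndex : Matrix (Fin m) (Fin t × Fin p) ℂ) *
      (trunc t W)⁻¹ * (V.submatrix leadIndex id : Matrix (Fin t × Fin p) (Fin n) ℂ))
    (hX : HasSum (fun t => S (t + 1) - S t) X) : HasInfiniteForm U W V X := by
  obtain ⟨L', hL'low, hL'u, hRup⟩ := exists_isBlockLower_infMul_isBlockUpper hW
  obtain ⟨L, hLlow, hL'L, hLL'⟩ := hL'low.exists_inverse hL'u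
  set R := infMul L' W with hR
  have hRt : ∀ t, trunc t R = trunc t L' * trunc t W := trunc_infMul_of_isBlockLower hL'low W
  obtain ⟨R', hR'up, hRR', hR'R⟩ := hRup.exists_inverse fun t => by
    rw [hRt]
    exact (hL'u t).mul (hW t)
  have hLt : ∀ t, trunc t L * trunc t L' = 1 := fun t => by
    rw [← trunc_infMul_of_isBlockLower hLlow, hLL', trunc_one]
  have hRt' : ∀ t, trunc t R * trunc t R' = 1 := fun t => by
    rw [← trunc_one, ← hRR']
    exact (submatrix_infMul_of_isBlockUpper R hR'up t _).symm
  have hLR : infMul L R = W := eq_of_trunc_eq fun t => by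
    rw [trunc_infMul_of_isBlockLower hLlow, hRt, ← Matrix.mul_assoc, hLt, Matrix.one_mul]
  have hinv : ∀ t, (trunc t W)⁻¹ = trunc t R' * trunc t L' := fun t => by
    refine Matrix.inv_eq_right_inv ?_
    rw [← hLR, trunc_infMul_of_isBlockLower hLlow, Matrix.mul_assoc,
      ← Matrix.mul_assoc (trunc t R), hRt', Matrix.one_mul, hLt]
  refine ⟨L, L', R, R', hLlow, hL'low, hLL', hL'L, hRup, hR'up, hRR', hR'R, hLR, ?_⟩
  have hpart : ∀ t, S t = ∑ k ∈ Finset.range t, (Matrix.of fun i j =>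
      ∑ x : Fin p, infMul U R' i (k, x) * infMul L' V (k, x) j : Matrix (Fin m) (Fin n) ℂ) := by
    intro t
    rw [hS, hinv, ← Matrix.mul_assoc, Matrix.mul_assoc,
      ← submatrix_infMul_of_isBlockUpper U hR'up t id,
      ← submatrix_infMul_of_isBlockLower hL'low V t id]
    ext i j
    simp [Matrix.mul_apply, Matrix.sum_apply, Fintype.sum_prod_type, Finset.sum_range, leadIndex]
  convert hX using 2 with k
  rw [hpart (k + 1), hpart k, Finset.sum_range_succ, add_sub_cancel_left]

end Truncation

/-! ### The low-rank form of the iterates and of their limit -/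

theorem mainTheorem2 {m n p q : ℕ} (N : NARE m n p q) (α β : ℂ)
    (hinv : N.ShiftsInvertible α β) (hsep : N.Separated α β) (hnb : N.NoBreakdown α β) :
    (∀ t : ℕ, 1 ≤ t →
      IsUnit (1 - N.TD α β t * N.TA α β t) ∧
      N.iter α β t = N.UA α β t * (1 - N.TD α β t * N.TA α β t)⁻¹ * N.VD α β t) ∧
    ∀ (Xs : Matrix (Fin m) (Fin n) ℂ) (Ys : Matrix (Fin n) (Fin m) ℂ),
      N.IsStabilizing Xs → N.IsWeaklyDualStabilizing Ys →
        (∀ X : Matrix (Fin m) (Fin n) ℂ, N.IsStabilizing X → X = Xs) ∧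
        Tendsto (fun t => N.iter α β t) atTop (𝓝 Xs) ∧
        HasInfiniteForm (N.UAInf α β) (1 - infMul (N.TDInf α β) (N.TAInf α β)) (N.VDInf α β)
          Xs := by
  refine ⟨fun t _ => ⟨NARE.isUnit_one_sub_TD_mul_TA hinv hnb t, NARE.iter_eq_UA_mul hinv hnb t⟩,
    fun Xs Ys hX hY => ⟨fun X hX' => ?_, NARE.tendsto_iter hinv hsep hnb hX hY, ?_⟩⟩
  · exact tendsto_nhds_unique (NARE.tendsto_iter hinv hsep hnb hX' hY)
      (NARE.tendsto_iter hinv hsep hnb hX hY)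
  · have hTD : IsBlockLower (N.TDInf α β) := fun i j x y hij => by
      simp [NARE.TDInf, NARE.blockTD, hij.ne, hij.not_gt]
    have ht : ∀ t, trunc t (1 - infMul (N.TDInf α β) (N.TAInf α β)) =
        1 - N.TD α β t * N.TA α β t := fun t => by
      have h₁ := trunc_infMul_of_isBlockLower hTD (N.TAInf α β) t
      have h₂ := trunc_one (a := p) t
      change trunc t 1 - trunc t (infMul _ _) = _
      rw [h₁, h₂]
      rfl
    refine hasInfiniteForm_of_hasSum (S := N.iter α β) (fun t => ?_) (fun t => ?_)
      (NARE.hasSum_iter_succ_sub hinv hsep hnb hX hY)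
    · rw [ht]
      exact NARE.isUnit_one_sub_TD_mul_TA hinv hnb t
    · rw [ht]
      exact NARE.iter_eq_UA_mul hinv hnb t
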